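/- **Setting.** Let $K,M\in\mathbb N$, $M\ge 1$, and $P>0$. The channel with $K$ transmitters is $Y(m)=\sum_{k=1}^K H_k(m)x_k(m)+N(m)$, $m=1,\dots,M$, with complex transmit symbols satisfying $|x_k(m)|^2\le P$. The real and imaginary parts of the fading coefficients $H_k(m)$ and of the noise $N(m)$ are centered and sub-gaussian, and those of $H_k(m)$ have variance $1$. The sub-gaussian norm of a random variable $X$ is $\inf\{t>0:\ \mathbb E e^{\lambda(X-\mathbb EX)}\le e^{\lambda^2t^2/2}\ \forall\lambda\in\mathbb R\}$, and $X$ is sub-gaussian if it is finite. Let $H\in\mathbb R^{2MK}$ and $N\in\mathbb R^{2M}$ be the vectors of all real and imaginary parts of fading and noise. Assume that $H=AR$ and $N=BR$, where $R$ is a vector of $2MK+2M$ independent random variables with sub-gaussian norm at most $1$ and, for some $\sigma_F,\sigma_N\ge 0$, $$A=\begin{pmatrix}\sigma_F\,\mathbf{id}_{2MK}&0\end{pmatrix},\qquad B=\begin{pmatrix}0&\sigma_N\,\mathbf{id}_{2M}\end{pmatrix}.$$ Let $\mathcal S_1,\dots,\mathcal S_K\subseteq\mathbb R$ be closed and let $f:\mathcal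 S_1\times\dots\times\mathcal S_K\to\mathbb R$ be measurable with $f(s_1,\dots,s_K)=G\big(\sum_k f_k(s_k)\big)$, where the $f_k:\mathcal S_k\to\mathbb R$ are bounded and measurable and $G:\mathcal D\to\mathbb R$ is measurable on a measurable set $\mathcal D\subseteq\mathbb R$ containing all the sums $\sum_k f_k(s_k)$. Let $\Phi:[0,\infty)\to[0,\infty)$ be strictly increasing with $\Phi(0)=0$ and $|G(x)-G(y)|\le\Phi(|x-y|)$ for all $x,y\in \mathcal D$. Put $\Phi^{-1}(\varepsilon)=\inf\{t\ge 0:\Phi(t)\ge\varepsilon\}$, which is the usual inverse if $\varepsilon$ is in the range of $\Phi$ (with the convention $\inf\emptyset=0$). Let $$\bar\Delta=\sum_k\big(\sup f_k-\inf f_k\big),\qquad \Delta=\max_k\big(\sup f_k-\inf f_k\big),$$ $$L'=\Big(\sqrt{\bar\Delta}\,\sigma_F+\sqrt{\tfrac{\Delta}{P}}\,\sigma_N\Big)^2,\qquad F'=L'\Big(\sqrt{2K\bar\Delta}\,\sigma_F+\sqrt{\tfrac{2\Delta}{P}}\,\sigma_N\Big)^2 .$$ **Statement.** There exist pre- and post-processing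 operations, namely randomized encoders that map $s_k\in\mathcal S_k$ to $(x_k(1),\dots,x_k(M))$, obey the power constraint $|x_k(m)|^2\le P$ almost surely, and use randomness that is independent between transmitters and independent of the channel, and a measurable decoder that maps $(Y(1),\dots,Y(M))$ to an estimate $\bar f$, such that for all $(s_1,\dots,s_K)\in\mathcal S_1\times\dots\times\mathcal S_K$ and all $\varepsilon>0$ $$\mathbb P\big(|\bar f-f(s_1,\dots,s_K)|\ge\varepsilon\big)\le 2\exp\Big(-\frac{M\,\Phi^{-1}(\varepsilon)^2}{16F'+4\Phi^{-1}(\varepsilon)L'}\Big)+2\exp\Big(-\frac{M\,\Phi^{-1}(\varepsilon)^2}{256F'+32\Phi^{-1}(\varepsilon)L'}\Big).$$ (If a denominator is $0$, which happens only for trivial data, the quotient is read as $0$.) Moreover, this is the special case of the general constants for correlated channels: $A$ generates user-uncorrelated fading (for $k_1\ne k_2$ the real parts of $H_{k_1}(m)$ and $H_{k_2}(m)$ are independent, and so are the imaginary parts), and with $\|\cdot\|$ the operator norm, $\|\cdot\|_F$ the Frobenius norm, and $A_i=A$, $\eta=\|(A+A_i)(A-A_i)^{T}\|$, one has $$\Big(\sqrt{\bar\Delta}\,\|A\|+\sqrt{\tfrac{\Delta}{P}}\,\|B\|\Big)^2=L',\qquad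 L'\Big(\sqrt{\tfrac{\bar\Delta}{M}}\,\|A\|_F+\sqrt{\tfrac{\Delta}{PM}}\,\|B\|_F\Big)^2=F',$$ $$\Big(4\sqrt{2M}\,\bar\Delta\,\eta+4\tfrac{\Delta}{\sqrt{PM}}\,\|AB^{T}\|_F\Big)^2=0 .$$ -/

import Mathlib

open MeasureTheory ProbabilityTheory
open scoped ENNReal NNReal Matrix

/-! ### Sub-gaussian random variables -/

/-- The sub-gaussian norm
`inf {t > 0 : ∀ l, E exp (l (X - E X)) ≤ exp (l² t² / 2)}`, with value `∞` if there is no such `t`.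
(`HasSubgaussianMGF Z c μ` says that `exp (l Z)` is integrable and
`E exp (l Z) ≤ exp (c l² / 2)` for all real `l`.) -/
noncomputable def subgaussianNorm {Ω : Type*} [MeasurableSpace Ω] (X : Ω → ℝ) (μ : Measure Ω) :
    ℝ≥0∞ :=
  ⨅ (t : ℝ≥0) (_ : 0 < t) (_ : HasSubgaussianMGF (fun ω => X ω - ∫ ω', X ω' ∂μ) (t ^ 2) μ),
    (t : ℝ≥0∞)

/-- A sub-gaussian random variable: the sub-gaussian norm is finite. -/
def IsSubgaussian {Ω : Type*} [MeasurableSpace Ω] (X : Ω → ℝ) (μ : Measure Ω) : Prop :=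
  subgaussianNorm X μ < ∞

/-! ### The channel -/

/-- Real part (`j = 0`) or imaginary part (`j = 1`) of a complex number. -/
def cpart (j : Fin 2) (z : ℂ) : ℝ := ![z.re, z.im] j

/-- Positions `(m, j, k)` in the vector of all fading coefficients: channel use `m`,
real or imaginary part `j`, user `k`.  There are `2 M K` of them. -/
abbrev FadingIdx (K M : ℕ) : Type := Fin M × Fin 2 × Fin K

/-- Positions `(m, j)` in the vector of all noise instances.  There are `2 M` of them. -/
abbrev NoiseIdx (M : ℕ) : Type := Fin M × Fin 2

/-- Positions in the vector of the `2 M K + 2 M` independent sources. -/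
abbrev SourceIdx (K M : ℕ) : Type := FadingIdx K M ⊕ NoiseIdx M

/-- The real vector of all fading coefficients. -/
def fadingVec {Ω : Type*} {K M : ℕ} (H : Fin K → Fin M → Ω → ℂ) (ω : Ω) : FadingIdx K M → ℝ :=
  fun i => cpart i.2.1 (H i.2.2 i.1 ω)

/-- The real vector of all noise instances. -/
def noiseVec {Ω : Type*} {M : ℕ} (N : Fin M → Ω → ℂ) (ω : Ω) : NoiseIdx M → ℝ :=
  fun i => cpart i.2 (N i.1 ω)

/-- The standing assumptions on fading `H k m` and noise `N m`: real and imaginary parts are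
centered sub-gaussian random variables, and those of the fading have variance one. -/
structure IsFadingChannel {Ω : Type*} [MeasurableSpace Ω] (μ : Measure Ω) {K M : ℕ}
    (H : Fin K → Fin M → Ω → ℂ) (N : Fin M → Ω → ℂ) : Prop where
  measurable_fading : ∀ k m, Measurable (H k m)
  measurable_noise : ∀ m, Measurable (N m)
  fading_subgaussian : ∀ k m j, IsSubgaussian (fun ω => cpart j (H k m ω)) μ
  fading_mean : ∀ k m j, ∫ ω, cpart j (H k m ω) ∂μ = 0
  fading_variance : ∀ k m j, variance (fun ω => cpart j (H k m ω)) μ = 1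
  noise_subgaussian : ∀ m j, IsSubgaussian (fun ω => cpart j (N m ω)) μ
  noise_mean : ∀ m j, ∫ ω, cpart j (N m ω) ∂μ = 0

/-- The correlation in fading and noise is described by the matrices `A` and `B` and the vector
`R` of independent random variables of sub-gaussian norm at most one: `H = A R` and `N = B R`. -/
structure IsCorrelationModel {Ω : Type*} [MeasurableSpace Ω] (μ : Measure Ω) {K M : ℕ}
    (H : Fin K → Fin M → Ω → ℂ) (N : Fin M → Ω → ℂ)
    (A : Matrix (FadingIdx K M) (SourceIdx K M) ℝ) (B : Matrix (NoiseIdx M) (SourceIdx K M) ℝ)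
    (R : SourceIdx K M → Ω → ℝ) : Prop where
  measurable_source : ∀ i, Measurable (R i)
  indep : iIndepFun R μ
  norm_le_one : ∀ i, subgaussianNorm (R i) μ ≤ 1
  fading_eq : ∀ ω, fadingVec H ω = A *ᵥ (fun i => R i ω)
  noise_eq : ∀ ω, noiseVec N ω = B *ᵥ (fun i => R i ω)

/-- `A` generates user-uncorrelated fading: in the vector `A R`, the entries of two different users
at the same channel use and in the same (real or imaginary) part are independent. -/
def GeneratesUserUncorrelated {Ω : Type*} [MeasurableSpace Ω] (μ : Measure Ω) {K M : ℕ}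
    (A : Matrix (FadingIdx K M) (SourceIdx K M) ℝ) (R : SourceIdx K M → Ω → ℝ) : Prop :=
  ∀ (k₁ k₂ : Fin K), k₁ ≠ k₂ → ∀ (j : Fin 2) (m : Fin M),
    IndepFun (fun ω => (A *ᵥ (fun i => R i ω)) (m, j, k₁))
      (fun ω => (A *ᵥ (fun i => R i ω)) (m, j, k₂)) μ

/-- The matrix `(σF · id, 0)`. -/
noncomputable def uncorrelatedA (K M : ℕ) (σF : ℝ) : Matrix (FadingIdx K M) (SourceIdx K M) ℝ :=
  Matrix.fromCols (σF • (1 : Matrix (FadingIdx K M) (FadingIdx K M) ℝ)) 0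

/-- The matrix `(0, σN · id)`. -/
noncomputable def uncorrelatedB (K M : ℕ) (σN : ℝ) : Matrix (NoiseIdx M) (SourceIdx K M) ℝ :=
  Matrix.fromCols 0 (σN • (1 : Matrix (NoiseIdx M) (NoiseIdx M) ℝ))

/-- The channel output `Y(m) = ∑ k, H k m * x k m + N m` for transmit symbols `x`. -/
def channelOutput {Ω : Type*} {K M : ℕ} (H : Fin K → Fin M → Ω → ℂ) (N : Fin M → Ω → ℂ)
    (x : Fin K → Fin M → ℂ) (ω : Ω) : Fin M → ℂ :=
  fun m => ∑ k, H k m ω * x k m + N m ω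

/-! ### Distributed function approximation -/

/-- A distributed function approximation scheme: each transmitter `k` has a randomized
pre-processing map from its message `s ∈ S k` to `M` channel inputs, given as the conditional law of
the inputs, and the receiver has a post-processing map. -/
structure DFAScheme {K : ℕ} (S : Fin K → Set ℝ) (M : ℕ) where
  enc : ∀ k, Kernel (S k) (Fin M → ℂ)
  isMarkov_enc : ∀ k, IsMarkovKernel (enc k)
  dec : (Fin M → ℂ) → ℝ
  measurable_dec : Measurable dec

/-- The peak power constraint `|x_k(m)|² ≤ P`. -/
def DFAScheme.PowerConstrained {K M : ℕ} {S : Fin K → Set ℝ} (E : DFAScheme S M) (P : ℝ) : Prop :=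
  ∀ k (s : S k), ∀ᵐ x ∂(E.enc k s), ∀ m, ‖x m‖ ^ 2 ≤ P

/-- The probability that the estimate of `f s` produced by the scheme over the channel `(H, N)` is
off by at least `ε`.  The randomness of the transmitters is independent between transmitters
and independent of the channel. -/
noncomputable def DFAScheme.errorProb {Ω : Type*} [MeasurableSpace Ω] {K M : ℕ}
    {S : Fin K → Set ℝ} (E : DFAScheme S M) (μ : Measure Ω)
    (H : Fin K → Fin M → Ω → ℂ) (N : Fin M → Ω → ℂ)
    (f : (∀ k, S k) → ℝ) (s : ∀ k, S k) (ε : ℝ) : ℝ :=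
  ((Measure.pi fun k => E.enc k (s k)).prod μ).real
    {p | ε ≤ |E.dec (channelOutput H N p.1 p.2) - f s|}

/-! ### The class of functions -/

/-- A representation `f s = F (∑ k, f_k (s k))` with bounded measurable inner functions `f_k` and a
measurable outer function `F` on a measurable set `D` containing all the inner sums. -/
structure NomographicRep {K : ℕ} (S : Fin K → Set ℝ) (f : (∀ k, S k) → ℝ) where
  inner : ∀ k, S k → ℝ
  measurable_inner : ∀ k, Measurable (inner k)
  bounded_inner : ∀ k, ∃ C : ℝ, ∀ s, |inner k s| ≤ C
  D : Set ℝ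
  measurableSet_D : MeasurableSet D
  sum_mem : ∀ s : ∀ k, S k, ∑ k, inner k (s k) ∈ D
  outer : D → ℝ
  measurable_outer : Measurable outer
  eq_outer : ∀ s, f s = outer ⟨∑ k, inner k (s k), sum_mem s⟩

namespace NomographicRep

variable {K : ℕ} {S : Fin K → Set ℝ} {f : (∀ k, S k) → ℝ}

/-- `Φ : [0, ∞) → [0, ∞)` (only its values on `[0, ∞)` matter) is an increment majorant: strictly
increasing, `Φ 0 = 0`, and `|F x - F y| ≤ Φ |x - y|` on `D`. -/
structure IsIncrementMajorant (r : NomographicRep S f) (Φ : ℝ → ℝ) : Prop where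
  strictMonoOn : StrictMonoOn Φ (Set.Ici 0)
  map_zero : Φ 0 = 0
  abs_sub_le : ∀ x y : r.D, |r.outer x - r.outer y| ≤ Φ |(x : ℝ) - y|

/-- `φ_max,k - φ_min,k`. -/
noncomputable def spread (r : NomographicRep S f) (k : Fin K) : ℝ :=
  (⨆ s, r.inner k s) - ⨅ s, r.inner k s

/-- The total spread of the inner part. -/
noncomputable def totalSpread (r : NomographicRep S f) : ℝ := ∑ k, r.spread k

/-- The max-spread of the inner part. -/
noncomputable def maxSpread (r : NomographicRep S f) : ℝ := ⨆ k, r.spread k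

end NomographicRep

/-- The inverse of an increment majorant at `ε`, as the smallest `t ≥ 0` with `Φ t ≥ ε` (infimum);
by `majorantInv_apply` this is the usual inverse at every `ε` in the range of `Φ`. -/
noncomputable def majorantInv (Φ : ℝ → ℝ) (ε : ℝ) : ℝ := sInf {t | 0 ≤ t ∧ ε ≤ Φ t}

theorem majorantInv_apply {Φ : ℝ → ℝ} (h : StrictMonoOn Φ (Set.Ici 0)) {t : ℝ} (ht : 0 ≤ t) :
    majorantInv Φ (Φ t) = t := by
  have : {u | 0 ≤ u ∧ Φ t ≤ Φ u} = Set.Ici t := by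
    ext u
    constructor
    · rintro ⟨hu, h'⟩
      exact (h.le_iff_le ht hu).1 h'
    · intro hu
      have hu0 : 0 ≤ u := le_trans ht hu
      exact ⟨hu0, (h.le_iff_le ht hu0).2 hu⟩
  rw [majorantInv, this, csInf_Ici]

/-! ### The constants of the error bound -/

open scoped Matrix.Norms.L2Operator in
/-- The operator norm of a real matrix with respect to the Euclidean norms. -/
noncomputable def matOpNorm {m n : Type*} [Fintype m] [Fintype n] [DecidableEq n]
    (A : Matrix m n ℝ) : ℝ := ‖A‖

/-- The Frobenius norm of a real matrix. -/
noncomputable def matFrobNorm {m n : Type*} [Fintype m] [Fintype n] (A : Matrix m n ℝ) : ℝ :=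
  √(∑ i, ∑ j, A i j ^ 2)

/-- `L`, for total spread `Δt` and max-spread `Δm`. -/
noncomputable def constL {K M : ℕ} (Δt Δm P : ℝ)
    (A : Matrix (FadingIdx K M) (SourceIdx K M) ℝ)
    (B : Matrix (NoiseIdx M) (SourceIdx K M) ℝ) : ℝ :=
  (√Δt * matOpNorm A + √(Δm / P) * matOpNorm B) ^ 2

/-- `F`, for total spread `Δt` and max-spread `Δm`. -/
noncomputable def constF {K M : ℕ} (Δt Δm P : ℝ)
    (A : Matrix (FadingIdx K M) (SourceIdx K M) ℝ)
    (B : Matrix (NoiseIdx M) (SourceIdx K M) ℝ) : ℝ :=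
  constL Δt Δm P A B *
    (√(Δt / M) * matFrobNorm A + √(Δm / (P * M)) * matFrobNorm B) ^ 2

/-- `D`, for total spread `Δt`, max-spread `Δm`, and the user-uncorrelated approximation `Ai`
of `A`; `η` is the operator norm of `(A + Ai) (A - Ai)ᵀ`. -/
noncomputable def constD {K M : ℕ} (Δt Δm P : ℝ)
    (A Ai : Matrix (FadingIdx K M) (SourceIdx K M) ℝ)
    (B : Matrix (NoiseIdx M) (SourceIdx K M) ℝ) : ℝ :=
  (4 * √(2 * M) * Δt * matOpNorm ((A + Ai) * (A - Ai)ᵀ) +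
    4 * (Δm / √(P * M)) * matFrobNorm (A * Bᵀ)) ^ 2

/-- `L'`. -/
noncomputable def constL' (Δt Δm P σF σN : ℝ) : ℝ := (√Δt * σF + √(Δm / P) * σN) ^ 2

/-- `F'`. -/
noncomputable def constF' (K : ℕ) (Δt Δm P σF σN : ℝ) : ℝ :=
  constL' Δt Δm P σF σN * (√(2 * K * Δt) * σF + √(2 * Δm / P) * σN) ^ 2

/-!
Every transmitter sends a real amplitude whose energy is an affine image of `f_k (s_k)`, the same
for all users up to a shift, and repeats it in all `M` channel uses. The contributions of the
sources to the output being independent and centered, the `2 M` real and imaginary parts of the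
channel output are independent, centered and sub-gaussian (`iIndepFun_receivedPart`,
`hasSubgaussianMGF_receivedPart`), and their second moment is the total transmitted energy
plus the noise energy (`integral_receivedPart_sq`). Hence an affine function of the received energy
is an unbiased estimate of `∑ k, f_k (s_k)`.

Its concentration is a Bernstein inequality for squares of independent sub-gaussian variables
(`measureReal_sum_sq_sub_ge_le`). In the units of the inner functions the variance proxy of the
received parts is at most `L'`, and `F' ≥ 2 L'²` (`two_mul_constL'_sq_le_constF'`), so the second of
the two exponentials in the claim is already an upper bound. That there are no correlations between
different parts of the output is what makes a separate bound for off-diagonal terms unnecessary.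

The estimate of the inner sum need not lie in the domain of the outer function. The receiver
evaluates the outer function at nearby points of the domain
(`exists_measurable_majorantInv_le_two_mul_abs_sub`), which costs a factor `2` in the deviation; the
constants `256` and `32` leave room for it.
-/

/-! ### Elementary bounds for the exponential function -/

theorem abs_exp_sub_one_sub_id_le_sq_mul_exp_abs (x : ℝ) :
    |Real.exp x - 1 - x| ≤ x ^ 2 * Real.exp |x| := by
  have h := Complex.norm_exp_sub_sum_le_norm_mul_exp (x : ℂ) 2
  rw [Complex.norm_real, Real.norm_eq_abs, sq_abs] at h
  rw [← Real.norm_eq_abs, ← Complex.norm_real]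
  convert h using 2
  simp [Finset.sum_range_succ]
  ring

theorem sq_le_exp {x : ℝ} (hx : 0 ≤ x) : x ^ 2 ≤ Real.exp x := by
  have h := Real.quadratic_le_exp_of_nonneg (x := x / 2) (by positivity)
  have h2 : x ≤ Real.exp (x / 2) := by nlinarith [sq_nonneg (x - 2)]
  calc x ^ 2 ≤ Real.exp (x / 2) ^ 2 := by gcongr
    _ = Real.exp x := by rw [← Real.exp_nat_mul]; congr 1; push_cast; ring

/-! ### Squares of sub-gaussian random variables -/

theorem lintegral_exp_sq_gaussianReal :
    ∫⁻ x, ENNReal.ofReal (Real.exp (3 / 8 * x ^ 2)) ∂(gaussianReal 0 1) = 2 := by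
  have hpdf : ∀ x : ℝ, gaussianPDF 0 1 x * ENNReal.ofReal (Real.exp (3 / 8 * x ^ 2)) =
      ENNReal.ofReal ((√(2 * Real.pi))⁻¹ * Real.exp (-(1 / 8) * x ^ 2)) := by
    intro x
    rw [gaussianPDF, ← ENNReal.ofReal_mul (gaussianPDFReal_nonneg _ _ _), gaussianPDFReal,
      mul_assoc, ← Real.exp_add]
    congr 3
    · simp
    · simp; ring
  rw [gaussianReal_of_var_ne_zero _ one_ne_zero, lintegral_withDensity_eq_lintegral_mul _
    (measurable_gaussianPDF 0 1) (by fun_prop)]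
  simp only [Pi.mul_apply, hpdf]
  rw [← ofReal_integral_eq_lintegral_ofReal
    ((integrable_exp_neg_mul_sq (by norm_num)).const_mul _) (ae_of_all _ fun x => by positivity),
    integral_const_mul, integral_gaussian]
  have : Real.pi / (1 / 8) = 2 ^ 2 * (2 * Real.pi) := by ring
  rw [this, Real.sqrt_mul (by norm_num) (2 * Real.pi), Real.sqrt_sq (by norm_num)]
  have : √(2 * Real.pi) ≠ 0 := by positivity
  field_simp
  simp

section Subgaussian

variable {Ω : Type*} [MeasurableSpace Ω] {μ : Measure Ω}

/-- The definition of the norm gives the bound on the moment generating function for every `t > 1`;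
it passes to the limit `t → 1`. -/
theorem hasSubgaussianMGF_of_subgaussianNorm_le_one {X : Ω → ℝ} (h : subgaussianNorm X μ ≤ 1) :
    HasSubgaussianMGF (fun ω => X ω - ∫ ω', X ω' ∂μ) 1 μ := by
  have key : ∀ t : ℝ≥0, 1 < t →
      HasSubgaussianMGF (fun ω => X ω - ∫ ω', X ω' ∂μ) (t ^ 2) μ := by
    intro t ht
    have h' : subgaussianNorm X μ < t := h.trans_lt (by exact_mod_cast ht)
    simp only [subgaussianNorm, iInf_lt_iff] at h'
    obtain ⟨r, _, hr, hrt⟩ := h'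
    refine ⟨hr.integrable_exp_mul, fun l => (hr.mgf_le l).trans ?_⟩
    have : r ≤ t := by exact_mod_cast hrt.le
    gcongr
  refine ⟨(key 2 (by norm_num)).integrable_exp_mul, fun l => ?_⟩
  have hlim : Filter.Tendsto (fun t : ℝ≥0 => Real.exp ((t ^ 2 : ℝ≥0) * l ^ 2 / 2))
      (nhdsWithin 1 (Set.Ioi 1)) (nhds (Real.exp ((1 ^ 2 : ℝ≥0) * l ^ 2 / 2))) := by
    have : Continuous (fun t : ℝ≥0 => Real.exp ((t ^ 2 : ℝ≥0) * l ^ 2 / 2)) := by fun_prop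
    exact this.continuousAt.tendsto.mono_left nhdsWithin_le_nhds
  rw [one_pow] at hlim
  exact ge_of_tendsto hlim (eventually_mem_nhdsWithin.mono fun t ht => (key t ht).mgf_le l)

theorem ProbabilityTheory.HasSubgaussianMGF.mono_const {X : Ω → ℝ} {c c' : ℝ≥0}
    (h : HasSubgaussianMGF X c μ) (hc : c ≤ c') : HasSubgaussianMGF X c' μ :=
  ⟨h.integrable_exp_mul, fun t => (h.mgf_le t).trans (by gcongr)⟩

/-- Linearization of the square by an independent standard gaussian variable `g`:
`exp (s W²) = E_g exp (√(2 s) g W)`, so that the sub-gaussian bound for `W` under the expectation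
over `g` reduces the claim to the gaussian case. -/
theorem lintegral_exp_sq_le_two [SFinite μ] {W : Ω → ℝ} {v : ℝ≥0} (hv : 0 < v)
    (hW : HasSubgaussianMGF W v μ) :
    ∫⁻ ω, ENNReal.ofReal (Real.exp (3 / (8 * v) * W ω ^ 2)) ∂μ ≤ 2 := by
  have hv' : (0 : ℝ) < v := hv
  -- `b = √(2 s)` for the exponent `s = 3 / (8 v)`
  set b : ℝ := √(3 / (4 * v)) with hb
  have hb2 : b ^ 2 = 3 / (4 * v) := Real.sq_sqrt (by positivity)
  have h1 : ∀ ω, ENNReal.ofReal (Real.exp (3 / (8 * v) * W ω ^ 2)) =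
      ∫⁻ x, ENNReal.ofReal (Real.exp (b * W ω * x)) ∂(gaussianReal 0 1) := by
    intro ω
    rw [← ofReal_integral_eq_lintegral_ofReal (integrable_exp_mul_gaussianReal _)
      (ae_of_all _ fun x => by positivity)]
    have := congrFun (mgf_fun_id_gaussianReal (μ := 0) (v := 1)) (b * W ω)
    rw [mgf] at this
    rw [this, mul_pow, hb2]
    congr 2
    simp; ring
  simp_rw [h1]
  have hWm := hW.aemeasurable
  rw [lintegral_lintegral_swap]
  · rw [← lintegral_exp_sq_gaussianReal]
    refine lintegral_mono fun x => ?_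
    have h2 : ∀ ω, b * W ω * x = (b * x) * W ω := fun ω => by ring
    simp_rw [h2]
    rw [← ofReal_integral_eq_lintegral_ofReal (hW.integrable_exp_mul _)
      (ae_of_all _ fun x => by positivity)]
    refine ENNReal.ofReal_le_ofReal ((hW.mgf_le (b * x)).trans_eq ?_)
    rw [mul_pow, hb2]
    congr 1
    field_simp
    ring
  · have : AEMeasurable (fun p : Ω × ℝ => W p.1) (μ.prod (gaussianReal 0 1)) := hWm.comp_fst
    simp only [Function.uncurry_def]
    fun_prop

theorem integrable_exp_sq {W : Ω → ℝ} [SFinite μ] {v : ℝ≥0} (hv : 0 < v)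
    (hW : HasSubgaussianMGF W v μ) :
    Integrable (fun ω => Real.exp (3 / (8 * v) * W ω ^ 2)) μ := by
  have hWm := hW.aemeasurable
  refine ⟨AEMeasurable.aestronglyMeasurable (by fun_prop), ?_⟩
  rw [hasFiniteIntegral_iff_ofReal (ae_of_all _ fun x => by positivity)]
  exact (lintegral_exp_sq_le_two hv hW).trans_lt (by simp)

theorem integral_exp_sq_le_two {W : Ω → ℝ} [SFinite μ] {v : ℝ≥0} (hv : 0 < v)
    (hW : HasSubgaussianMGF W v μ) :
    ∫ ω, Real.exp (3 / (8 * v) * W ω ^ 2) ∂μ ≤ 2 := by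
  rw [integral_eq_lintegral_of_nonneg_ae (ae_of_all _ fun x => by positivity)
    (integrable_exp_sq hv hW).1]
  exact ENNReal.toReal_le_of_le_ofReal (by norm_num)
    (by simpa using lintegral_exp_sq_le_two hv hW)

theorem integrable_exp_mul_sq_sub {W : Ω → ℝ} [SFinite μ] {v : ℝ≥0} (hv : 0 < v)
    (hW : HasSubgaussianMGF W v μ) {l : ℝ} (hl : |l| ≤ 1 / (10 * v)) (c : ℝ) :
    Integrable (fun ω => Real.exp (l * (W ω ^ 2 - c))) μ := by
  have hv' : (0 : ℝ) < v := hv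
  have hWm := hW.aemeasurable
  refine ((integrable_exp_sq hv hW).mul_const (Real.exp (-(l * c)))).mono'
    (AEMeasurable.aestronglyMeasurable (by fun_prop)) (ae_of_all _ fun ω => ?_)
  rw [Real.norm_eq_abs, Real.abs_exp, ← Real.exp_add, Real.exp_le_exp, mul_sub, ← sub_eq_add_neg]
  have : l ≤ 3 / (8 * v) := (le_abs_self l).trans (hl.trans
    (by rw [div_le_div_iff₀ (by positivity) (by positivity)]; linarith))
  gcongr

/-- A centered square of a sub-gaussian variable is sub-exponential. The second-order remainder of
the exponential function is absorbed into `exp (3 W² / (8 v))`, whose expectation is at most `2`. -/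
theorem mgf_sq_sub_integral_le [IsProbabilityMeasure μ] {W : Ω → ℝ} {v : ℝ≥0} (hv : 0 < v)
    (hW : HasSubgaussianMGF W v μ) {l : ℝ} (hl : |l| ≤ 1 / (10 * v)) :
    mgf (fun ω => W ω ^ 2 - ∫ ω', W ω' ^ 2 ∂μ) μ l ≤ Real.exp (27 * l ^ 2 * v ^ 2) := by
  have hv' : (0 : ℝ) < v := hv
  set c := ∫ ω', W ω' ^ 2 ∂μ with hc
  have hW2 : Integrable (fun ω => W ω ^ 2) μ := (hW.memLp 2).integrable_sq
  -- `1600 / 121 * v ^ 2` is `a⁻²` for `a = 11 / (40 v) = 3 / (8 v) - 1 / (10 v)`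
  set C : ℝ := l ^ 2 * (1600 / 121 * v ^ 2) with hC
  have hpt : ∀ ω, Real.exp (l * W ω ^ 2) ≤
      1 + l * W ω ^ 2 + C * Real.exp (3 / (8 * v) * W ω ^ 2) := by
    intro ω
    have h1 := (abs_le.1 (abs_exp_sub_one_sub_id_le_sq_mul_exp_abs (l * W ω ^ 2))).2
    have h2 : |l * W ω ^ 2| ≤ 1 / (10 * v) * W ω ^ 2 := by
      rw [abs_mul, abs_of_nonneg (sq_nonneg (W ω))]; gcongr
    have h3 := sq_le_exp (x := 11 / (40 * v) * W ω ^ 2) (by positivity)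
    have h4 : (l * W ω ^ 2) ^ 2 = C * (11 / (40 * v) * W ω ^ 2) ^ 2 := by
      rw [hC]; field_simp; ring
    calc Real.exp (l * W ω ^ 2) ≤ 1 + l * W ω ^ 2 + (l * W ω ^ 2) ^ 2 *
          Real.exp |l * W ω ^ 2| := by linarith
      _ ≤ 1 + l * W ω ^ 2 + C * (Real.exp (11 / (40 * v) * W ω ^ 2) *
          Real.exp (1 / (10 * v) * W ω ^ 2)) := by
        rw [h4, mul_assoc]
        gcongr
      _ = _ := by
        rw [← Real.exp_add]
        congr 3
        field_simp
        ring
  have hint := integrable_exp_sq hv hW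
  have hlin : Integrable (fun ω => 1 + l * W ω ^ 2) μ :=
    (integrable_const 1).add (hW2.const_mul l)
  have h1 : ∫ ω, Real.exp (l * W ω ^ 2) ∂μ ≤ 1 + l * c + 27 * l ^ 2 * v ^ 2 := by
    calc ∫ ω, Real.exp (l * W ω ^ 2) ∂μ
        ≤ ∫ ω, (1 + l * W ω ^ 2 + C * Real.exp (3 / (8 * v) * W ω ^ 2)) ∂μ := by
          refine integral_mono ?_ (hlin.add (hint.const_mul C)) hpt
          simpa using integrable_exp_mul_sq_sub hv hW hl 0
      _ = 1 + l * c + C * ∫ ω, Real.exp (3 / (8 * v) * W ω ^ 2) ∂μ := by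
          rw [integral_add hlin (hint.const_mul C),
            integral_add (integrable_const 1) (hW2.const_mul l), integral_const_mul,
            integral_const_mul]
          simp [hc]
      _ ≤ 1 + l * c + C * 2 := by gcongr; exact integral_exp_sq_le_two hv hW
      _ ≤ _ := by
          rw [hC]
          nlinarith [mul_nonneg (sq_nonneg l) (sq_nonneg (v : ℝ))]
  calc mgf (fun ω => W ω ^ 2 - c) μ l
      = Real.exp (-(l * c)) * ∫ ω, Real.exp (l * W ω ^ 2) ∂μ := by
        rw [mgf, ← integral_const_mul]
        congr 1 with ω
        rw [← Real.exp_add]; ring_nf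
    _ ≤ Real.exp (-(l * c)) * Real.exp (l * c + 27 * l ^ 2 * v ^ 2) := by
        gcongr
        refine h1.trans ?_
        have := Real.add_one_le_exp (l * c + 27 * l ^ 2 * v ^ 2)
        linarith
    _ = _ := by rw [← Real.exp_add]; ring_nf

/-- Bernstein's inequality for a sum of squares of independent sub-gaussian variables. -/
theorem measureReal_sum_sq_sub_ge_le [IsProbabilityMeasure μ] {ι : Type*} [Fintype ι]
    {W : ι → Ω → ℝ} (hind : iIndepFun W μ) (hm : ∀ i, Measurable (W i)) {v : ℝ≥0} (hv : 0 < v)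
    (hW : ∀ i, HasSubgaussianMGF (W i) v μ) {u : ℝ} (hu : 0 < u) :
    μ.real {ω | Fintype.card ι * u ≤ |∑ i, (W i ω ^ 2 - ∫ ω', W i ω' ^ 2 ∂μ)|} ≤
      2 * Real.exp (-(Fintype.card ι * u ^ 2 / (108 * v ^ 2 + 20 * v * u))) := by
  have hv' : (0 : ℝ) < v := hv
  set n : ℝ := (Fintype.card ι : ℝ) with hn
  have hn0 : 0 ≤ n := by positivity
  set Z : ι → Ω → ℝ := fun i ω => W i ω ^ 2 - ∫ ω', W i ω' ^ 2 ∂μ with hZ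
  have hZm : ∀ i, Measurable (Z i) := fun i => by fun_prop
  have hZind : iIndepFun Z μ :=
    hind.comp (fun i x => x ^ 2 - ∫ ω', W i ω' ^ 2 ∂μ) (fun i => by fun_prop)
  -- a near minimizer of `-l u + 27 l² v²` that stays below `1 / (10 v)`
  set l : ℝ := u / (54 * v ^ 2 + 10 * v * u) with hl
  have hl0 : 0 < l := by positivity
  have hlv : l ≤ 1 / (10 * v) := by
    rw [hl, div_le_div_iff₀ (by positivity) (by positivity)]
    nlinarith [sq_nonneg (v : ℝ)]
  have hmgf : ∀ r : ℝ, |r| ≤ 1 / (10 * v) →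
      Integrable (fun ω => Real.exp (r * (∑ i, Z i) ω)) μ ∧
      mgf (∑ i, Z i) μ r ≤ Real.exp (n * (27 * r ^ 2 * v ^ 2)) := by
    intro r hr
    refine ⟨hZind.integrable_exp_mul_sum hZm fun i _ =>
      integrable_exp_mul_sq_sub hv (hW i) hr _, ?_⟩
    rw [hZind.mgf_sum hZm]
    refine (Finset.prod_le_prod (fun _ _ => mgf_nonneg) fun i _ =>
      mgf_sq_sub_integral_le hv (hW i) hr).trans_eq ?_
    rw [Finset.prod_const, Finset.card_univ, ← Real.exp_nat_mul]
  have hexp : -l * (n * u) + n * (27 * l ^ 2 * v ^ 2) ≤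
      -(n * u ^ 2 / (108 * v ^ 2 + 20 * v * u)) := by
    have h1 : n * u ^ 2 / (108 * v ^ 2 + 20 * v * u) = n * (l * u / 2) := by
      rw [hl]; field_simp; ring
    have h2 : 54 * v ^ 2 * l ≤ u := by
      rw [hl, mul_div_assoc', div_le_iff₀ (by positivity)]
      nlinarith [mul_pos hv' (mul_pos hu hu)]
    have h3 : 27 * l ^ 2 * v ^ 2 ≤ l * u / 2 := by nlinarith
    rw [h1]
    nlinarith [mul_le_mul_of_nonneg_left h3 hn0]
  have hup : μ.real {ω | n * u ≤ (∑ i, Z i) ω} ≤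
      Real.exp (-(n * u ^ 2 / (108 * v ^ 2 + 20 * v * u))) := by
    have h := hmgf l (by rwa [abs_of_pos hl0])
    refine (measure_ge_le_exp_mul_mgf (n * u) hl0.le h.1).trans ?_
    refine (mul_le_mul_of_nonneg_left h.2 (Real.exp_pos _).le).trans ?_
    rwa [← Real.exp_add, Real.exp_le_exp]
  have hlo : μ.real {ω | (∑ i, Z i) ω ≤ -(n * u)} ≤
      Real.exp (-(n * u ^ 2 / (108 * v ^ 2 + 20 * v * u))) := by
    have h := hmgf (-l) (by rwa [abs_neg, abs_of_pos hl0])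
    refine (measure_le_le_exp_mul_mgf (-(n * u)) (by linarith) h.1).trans ?_
    refine (mul_le_mul_of_nonneg_left h.2 (Real.exp_pos _).le).trans ?_
    rw [← Real.exp_add, Real.exp_le_exp]
    refine le_trans (le_of_eq ?_) hexp
    ring
  calc _ ≤ μ.real ({ω | n * u ≤ (∑ i, Z i) ω} ∪ {ω | (∑ i, Z i) ω ≤ -(n * u)}) := by
        refine measureReal_mono fun ω hω => ?_
        simp only [Set.mem_ofPred_eq, Set.mem_union, Finset.sum_apply] at hω ⊢
        rcases le_abs.1 hω with h | h
        · exact Or.inl h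
        · exact Or.inr (by linarith)
    _ ≤ _ := (measureReal_union_le _ _).trans (by linarith)

/-- Functions of disjoint finite blocks of an independent family are independent. -/
theorem iIndepFun_of_pairwise_disjoint {ι κ : Type*} {R : κ → Ω → ℝ} (hR : iIndepFun R μ)
    (hm : ∀ j, Measurable (R j)) (T : ι → Finset κ)
    (hT : Pairwise (Function.onFun Disjoint T))
    (φ : ∀ i, (T i → ℝ) → ℝ) (hφ : ∀ i, Measurable (φ i)) :
    iIndepFun (fun i ω => φ i fun j => R j ω) μ := by
  classical
  have := hR.isProbabilityMeasure
  rw [iIndepFun_iff_measure_inter_preimage_eq_mul]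
  intro s A hA
  induction s using Finset.induction_on with
  | empty => simp
  | insert a s ha ih =>
    have hA' : ∀ i ∈ s, MeasurableSet (A i) := fun i hi => hA i (Finset.mem_insert_of_mem hi)
    rw [Finset.set_biInter_insert, Finset.prod_insert ha, ← ih hA']
    have hd : Disjoint (T a) (s.biUnion T) := by
      rw [Finset.disjoint_biUnion_right]
      exact fun i hi => hT (fun h => ha (h ▸ hi))
    have hind := hR.indepFun_finset (T a) (s.biUnion T) hd hm
    have hB : MeasurableSet (⋂ i ∈ s.attach, {x : (s.biUnion T) → ℝ |
        φ i.1 (fun j => x ⟨j.1, Finset.mem_biUnion.2 ⟨i.1, i.2, j.2⟩⟩) ∈ A i.1}) := by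
      refine Finset.measurableSet_biInter _ fun i _ => ?_
      exact ((hφ i.1).comp (measurable_pi_lambda _ fun j => measurable_pi_apply _)) (hA' i.1 i.2)
    have h := hind.measure_inter_preimage_eq_mul _ _
      ((hφ a) (hA a (Finset.mem_insert_self a s))) hB
    have e : (fun ω => fun j : s.biUnion T => R j ω) ⁻¹' (⋂ i ∈ s.attach,
        {x : (s.biUnion T) → ℝ |
        φ i.1 (fun j => x ⟨j.1, Finset.mem_biUnion.2 ⟨i.1, i.2, j.2⟩⟩) ∈ A i.1}) =
        ⋂ i ∈ s, (fun ω => φ i fun j => R j ω) ⁻¹' A i := by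
      ext ω
      simp
    rw [e] at h
    exact h

end Subgaussian

/-! ### Evaluation of the outer function at an approximate argument -/

theorem majorantInv_nonneg (Φ : ℝ → ℝ) (ε : ℝ) : 0 ≤ majorantInv Φ ε :=
  Real.sInf_nonneg fun _ h => h.1

theorem majorantInv_le {Φ : ℝ → ℝ} {ε t : ℝ} (ht : 0 ≤ t) (h : ε ≤ Φ t) : majorantInv Φ ε ≤ t :=
  csInf_le ⟨0, fun _ h => h.1⟩ ⟨ht, h⟩

/-- A measurable evaluation `G` of the outer function `F` at arguments `z` that need not lie in its
domain `D`: if `G z` is off from `F y` by `ε`, then `z` is off from `y` by at least half of the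
inverse majorant at `ε`. Here `G z` is the limit superior of the values of `F` at points of a fixed
countable dense subset of `D` whose distances to `z` tend to the distance of `z` from `D`. The limit
is needed because `D` may fail to be closed and `Φ` may jump at `0`. -/
theorem exists_measurable_majorantInv_le_two_mul_abs_sub {D : Set ℝ} {F : D → ℝ}
    {Φ : ℝ → ℝ} (hΦ : MonotoneOn Φ (Set.Ici 0)) (hF : ∀ x y : D, |F x - F y| ≤ Φ |(x : ℝ) - y|) :
    ∃ G : ℝ → ℝ, Measurable G ∧ ∀ (z : ℝ) (y : D) (ε : ℝ), ε ≤ |G z - F y| →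
      majorantInv Φ ε ≤ 2 * |z - y| := by
  classical
  rcases D.eq_empty_or_nonempty with rfl | hD
  · exact ⟨0, measurable_const, fun _ y => y.2.elim⟩
  have : Nonempty D := hD.to_subtype
  let d : ℕ → D := TopologicalSpace.denseSeq D
  have hd : DenseRange d := TopologicalSpace.denseRange_denseSeq D
  let p : ℕ → ℕ → ℝ → Prop := fun k n z => |z - d n| < Metric.infDist z D + 1 / (k + 1)
  have hex : ∀ k z, ∃ n, p k n z := by
    intro k z
    have hk : (0 : ℝ) < 1 / (k + 1) := by positivity
    obtain ⟨y, hy, hzy⟩ := (Metric.infDist_lt_iff hD).1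
      (lt_add_of_pos_right (Metric.infDist z D) hk)
    have hopen : IsOpen {x : D | dist z x < Metric.infDist z D + 1 / (k + 1)} :=
      isOpen_lt (by fun_prop) continuous_const
    obtain ⟨n, hn⟩ := hd.exists_mem_open hopen ⟨⟨y, hy⟩, hzy⟩
    exact ⟨n, by simpa [p, Real.dist_eq] using hn⟩
  let g : ℕ → ℝ → ℝ := fun k z => F (d (Nat.find (hex k z)))
  have hg : ∀ k, Measurable (g k) := fun k =>
    Measurable.find (f := fun n _ => F (d n)) (p := p k) (fun _ => measurable_const)
      (fun n => measurableSet_lt (by fun_prop)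
        ((Metric.continuous_infDist_pt D).measurable.add_const _)) (hex k)
  refine ⟨fun z => Filter.limsup (fun k => g k z) Filter.atTop, .limsup hg, fun z y ε h => ?_⟩
  refine le_of_forall_gt_imp_ge_of_dense fun u hu => ?_
  have hu0 : 0 ≤ u := le_trans (by positivity) hu.le
  have hev : ∀ᶠ k : ℕ in Filter.atTop, |g k z - F y| ≤ Φ u := by
    obtain ⟨k₀, hk₀⟩ := exists_nat_one_div_lt (sub_pos.2 hu)
    filter_upwards [Filter.eventually_ge_atTop k₀] with k hk
    refine (hF _ _).trans (hΦ (Set.mem_Ici.2 (abs_nonneg _)) hu0 ?_)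
    have h1 : |z - d (Nat.find (hex k z))| < Metric.infDist z D + 1 / (k + 1) :=
      Nat.find_spec (hex k z)
    have h2 : Metric.infDist z D ≤ |z - y| := by
      rw [← Real.dist_eq]; exact Metric.infDist_le_dist_of_mem y.2
    have h3 : (1 : ℝ) / (k + 1) ≤ 1 / (k₀ + 1) := Nat.one_div_le_one_div hk
    have h4 := abs_sub_le (d (Nat.find (hex k z)) : ℝ) z y
    rw [abs_sub_comm _ z] at h4
    linarith
  have hle : ∀ᶠ k : ℕ in Filter.atTop, g k z ≤ F y + Φ u := by
    filter_upwards [hev] with k hk; linarith [(abs_le.1 hk).2]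
  have hge : ∀ᶠ k : ℕ in Filter.atTop, F y - Φ u ≤ g k z := by
    filter_upwards [hev] with k hk; linarith [(abs_le.1 hk).1]
  have hup : Filter.limsup (fun k => g k z) Filter.atTop ≤ F y + Φ u :=
    Filter.limsup_le_of_le (Filter.isCoboundedUnder_le_of_eventually_le _ hge) hle
  have hlo : F y - Φ u ≤ Filter.limsup (fun k => g k z) Filter.atTop :=
    Filter.le_limsup_of_le (Filter.isBoundedUnder_of_eventually_le hle) fun b hb => by
      obtain ⟨k, h1, h2⟩ := (hge.and hb).exists
      exact h1.trans h2
  exact majorantInv_le hu0 (h.trans (abs_le.2 ⟨by linarith, by linarith⟩))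

/-! ### The constants for uncorrelated channels -/

section MatrixNorms

open scoped Matrix.Norms.L2Operator in
theorem matOpNorm_zero {m n : Type*} [Fintype m] [Fintype n] [DecidableEq n] :
    matOpNorm (0 : Matrix m n ℝ) = 0 :=
  norm_zero

open scoped Matrix.Norms.L2Operator in
theorem matOpNorm_of_mul_transpose_eq {m n : Type*} [Fintype m] [Fintype n] [DecidableEq m]
    [DecidableEq n] [Nonempty m] {A : Matrix m n ℝ} {σ : ℝ} (hσ : 0 ≤ σ)
    (hA : A * Aᵀ = Matrix.diagonal fun _ => σ ^ 2) : matOpNorm A = σ := by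
  have h := Matrix.l2_opNorm_conjTranspose_mul_self Aᴴ
  rw [Matrix.conjTranspose_conjTranspose, Matrix.l2_opNorm_conjTranspose,
    Matrix.conjTranspose_eq_transpose_of_trivial, hA, Matrix.l2_opNorm_diagonal,
    pi_norm_const, Real.norm_of_nonneg (sq_nonneg σ), sq] at h
  exact ((mul_self_inj hσ (norm_nonneg A)).1 h).symm

variable (K M : ℕ) (σ : ℝ)

theorem uncorrelatedA_mul_transpose :
    uncorrelatedA K M σ * (uncorrelatedA K M σ)ᵀ = Matrix.diagonal fun _ => σ ^ 2 := by
  rw [uncorrelatedA, Matrix.transpose_fromCols, Matrix.fromCols_mul_fromRows]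
  ext i j
  simp [Matrix.one_apply, Matrix.diagonal_apply, sq]

theorem uncorrelatedB_mul_transpose :
    uncorrelatedB K M σ * (uncorrelatedB K M σ)ᵀ = Matrix.diagonal fun _ => σ ^ 2 := by
  rw [uncorrelatedB, Matrix.transpose_fromCols, Matrix.fromCols_mul_fromRows]
  ext i j
  simp [Matrix.one_apply, Matrix.diagonal_apply, sq]

theorem uncorrelatedA_mul_uncorrelatedB_transpose (σ' : ℝ) :
    uncorrelatedA K M σ * (uncorrelatedB K M σ')ᵀ = 0 := by
  rw [uncorrelatedA, uncorrelatedB, Matrix.transpose_fromCols, Matrix.fromCols_mul_fromRows]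
  simp

theorem matFrobNorm_sq_of_mul_transpose_eq {m n : Type*} [Fintype m] [Fintype n] [DecidableEq m]
    {A : Matrix m n ℝ} {σ : ℝ} (hA : A * Aᵀ = Matrix.diagonal fun _ => σ ^ 2) :
    matFrobNorm A = √(Fintype.card m * σ ^ 2) := by
  rw [matFrobNorm]
  congr 1
  have h : ∀ i, ∑ j, A i j ^ 2 = σ ^ 2 := fun i => by
    have := congrFun (congrFun hA i) i
    simpa [Matrix.mul_apply, sq] using this
  simp [h]

end MatrixNorms

section Constants

variable {K M : ℕ}

/-- For `K = 0` the operator norm of the empty matrix is `0` instead of `σF`; the hypothesis `hK`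
makes this irrelevant. -/
theorem constL_uncorrelated (hM : 0 < M) {Δt Δm P σF σN : ℝ} (hσF : 0 ≤ σF) (hσN : 0 ≤ σN)
    (hK : K = 0 → Δt = 0) :
    constL Δt Δm P (uncorrelatedA K M σF) (uncorrelatedB K M σN) = constL' Δt Δm P σF σN := by
  have : Nonempty (Fin M) := ⟨⟨0, hM⟩⟩
  rw [constL, constL', matOpNorm_of_mul_transpose_eq hσN (uncorrelatedB_mul_transpose K M σN)]
  rcases Nat.eq_zero_or_pos K with rfl | hK0
  · simp [hK rfl]
  · have : Nonempty (Fin K) := ⟨⟨0, hK0⟩⟩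
    rw [matOpNorm_of_mul_transpose_eq hσF (uncorrelatedA_mul_transpose K M σF)]

theorem constF_uncorrelated (hM : 0 < M) {Δt Δm P σF σN : ℝ} (hσF : 0 ≤ σF) (hσN : 0 ≤ σN)
    (hK : K = 0 → Δt = 0) :
    constF Δt Δm P (uncorrelatedA K M σF) (uncorrelatedB K M σN) = constF' K Δt Δm P σF σN := by
  have hM' : (M : ℝ) ≠ 0 := by positivity
  rw [constF, constF', constL_uncorrelated hM hσF hσN hK,
    matFrobNorm_sq_of_mul_transpose_eq (uncorrelatedA_mul_transpose K M σF),
    matFrobNorm_sq_of_mul_transpose_eq (uncorrelatedB_mul_transpose K M σN),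
    ← Real.sqrt_mul' _ (by positivity), ← Real.sqrt_mul' _ (by positivity)]
  have e1 : Δt / M * (Fintype.card (FadingIdx K M) * σF ^ 2) = σF ^ 2 * (2 * K * Δt) := by
    simp; field_simp
  have e2 : Δm / (P * M) * (Fintype.card (NoiseIdx M) * σN ^ 2) = σN ^ 2 * (2 * Δm / P) := by
    simp; field_simp
  rw [e1, e2, Real.sqrt_mul (sq_nonneg _), Real.sqrt_mul (sq_nonneg _), Real.sqrt_sq hσF,
    Real.sqrt_sq hσN, mul_comm σF, mul_comm σN]

theorem constD_uncorrelated (Δt Δm P σF σN : ℝ) :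
    constD Δt Δm P (uncorrelatedA K M σF) (uncorrelatedA K M σF) (uncorrelatedB K M σN) = 0 := by
  rw [constD, uncorrelatedA_mul_uncorrelatedB_transpose, sub_self, Matrix.transpose_zero,
    Matrix.mul_zero, matOpNorm_zero]
  simp [matFrobNorm]

/-- `F'` dominates the variance term `L' ²` of a Bernstein bound with proxy `L'`. -/
theorem two_mul_constL'_sq_le_constF' (hK : 0 < K) {Δt Δm P σF σN : ℝ} (hσF : 0 ≤ σF)
    (hσN : 0 ≤ σN) (hΔt : 0 ≤ Δt) :
    2 * constL' Δt Δm P σF σN ^ 2 ≤ constF' K Δt Δm P σF σN := by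
  have hK1 : (1 : ℝ) ≤ K := by exact_mod_cast hK
  have h : √2 * (√Δt * σF + √(Δm / P) * σN) ≤ √(2 * K * Δt) * σF + √(2 * Δm / P) * σN := by
    rw [mul_add, ← mul_assoc, ← mul_assoc, ← Real.sqrt_mul (by norm_num),
      ← Real.sqrt_mul (by norm_num), mul_div_assoc]
    gcongr
    linarith
  have h2 : 2 * (√Δt * σF + √(Δm / P) * σN) ^ 2 ≤
      (√(2 * K * Δt) * σF + √(2 * Δm / P) * σN) ^ 2 := by
    calc _ = (√2 * (√Δt * σF + √(Δm / P) * σN)) ^ 2 := by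
          rw [mul_pow, Real.sq_sqrt (by norm_num)]
      _ ≤ _ := by gcongr
  rw [constF']
  have hL : 0 ≤ constL' Δt Δm P σF σN := sq_nonneg _
  calc 2 * constL' Δt Δm P σF σN ^ 2
      = constL' Δt Δm P σF σN * (2 * (√Δt * σF + √(Δm / P) * σN) ^ 2) := by
        rw [← constL']; ring
    _ ≤ _ := by gcongr

end Constants

/-! ### The channel output as a sum of independent contributions -/

theorem measurable_cpart (j : Fin 2) : Measurable (cpart j) := by
  fin_cases j
  · exact Complex.measurable_re
  · exact Complex.measurable_im

theorem cpart_add (j : Fin 2) (z w : ℂ) : cpart j (z + w) = cpart j z + cpart j w := by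
  fin_cases j <;> simp [cpart]

theorem cpart_mul_ofReal (j : Fin 2) (z : ℂ) (a : ℝ) : cpart j (z * a) = a * cpart j z := by
  fin_cases j <;> simp [cpart, mul_comm]

theorem cpart_sum {ι : Type*} (j : Fin 2) (s : Finset ι) (z : ι → ℂ) :
    cpart j (∑ i ∈ s, z i) = ∑ i ∈ s, cpart j (z i) := by
  fin_cases j <;> simp [cpart]

section Channel

variable {Ω : Type*} {K M : ℕ}
  {H : Fin K → Fin M → Ω → ℂ} {N : Fin M → Ω → ℂ}

/-- The sources that enter real or imaginary part `p.2` of the channel output at channel use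
`p.1`. -/
def receiverBlock (p : NoiseIdx M) : Finset (SourceIdx K M) :=
  (Finset.univ.map ⟨fun k : Fin K => ((p.1, p.2, k) : FadingIdx K M), fun k l h => by
    simpa using h⟩).disjSum {p}

theorem sum_receiverBlock (p : NoiseIdx M) (g : SourceIdx K M → ℝ) :
    ∑ i ∈ receiverBlock p, g i = ∑ k, g (.inl (p.1, p.2, k)) + g (.inr p) := by
  rw [receiverBlock, Finset.sum_disjSum, Finset.sum_map, Finset.sum_singleton]
  rfl

theorem pairwise_disjoint_receiverBlock :
    Pairwise (Function.onFun Disjoint (receiverBlock : NoiseIdx M → Finset (SourceIdx K M))) := by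
  intro p q hpq
  rw [Function.onFun, Finset.disjoint_left]
  rintro (i | i) hp hq <;> simp only [receiverBlock, Finset.inl_mem_disjSum, Finset.inr_mem_disjSum,
    Finset.mem_map, Finset.mem_univ, true_and, Finset.mem_singleton] at hp hq
  · obtain ⟨k, rfl⟩ := hp
    obtain ⟨l, h⟩ := hq
    obtain ⟨h1, h2, -⟩ := (Prod.ext_iff.1 h).imp_right Prod.ext_iff.1
    exact hpq (Prod.ext h1.symm h2.symm)
  · exact hpq (hp.symm.trans hq)

/-- The contributions of the individual sources to the received signal, when user `k` transmits
the real amplitude `x k` in every channel use. -/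
def sourceContribution (H : Fin K → Fin M → Ω → ℂ) (N : Fin M → Ω → ℂ) (x : Fin K → ℝ) :
    SourceIdx K M → Ω → ℝ :=
  Sum.elim (fun i ω => x i.2.2 * fadingVec H ω i) fun p ω => noiseVec N ω p

/-- The real (`p.2 = 0`) or imaginary (`p.2 = 1`) part of the channel output at channel use `p.1`,
when user `k` transmits the real amplitude `x k` in every channel use. -/
def receivedPart (H : Fin K → Fin M → Ω → ℂ) (N : Fin M → Ω → ℂ) (x : Fin K → ℝ)
    (p : NoiseIdx M) (ω : Ω) : ℝ :=
  cpart p.2 (channelOutput H N (fun k _ => (x k : ℂ)) ω p.1)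

theorem receivedPart_apply (x : Fin K → ℝ) (p : NoiseIdx M) (ω : Ω) :
    receivedPart H N x p ω = ∑ i ∈ receiverBlock p, sourceContribution H N x i ω := by
  rw [receivedPart, sum_receiverBlock, channelOutput, cpart_add, cpart_sum]
  simp [cpart_mul_ofReal, sourceContribution, fadingVec, noiseVec]

theorem receivedPart_eq_sum (x : Fin K → ℝ) (p : NoiseIdx M) :
    receivedPart H N x p = ∑ i ∈ receiverBlock p, sourceContribution H N x i := by
  ext ω
  rw [receivedPart_apply, Finset.sum_apply]

theorem uncorrelatedA_mulVec (σF : ℝ) (w : SourceIdx K M → ℝ) (i : FadingIdx K M) :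
    (uncorrelatedA K M σF *ᵥ w) i = σF * w (.inl i) := by
  simp [uncorrelatedA, Matrix.mulVec, dotProduct, Fintype.sum_sum_type, Matrix.one_apply]

theorem uncorrelatedB_mulVec (σN : ℝ) (w : SourceIdx K M → ℝ) (p : NoiseIdx M) :
    (uncorrelatedB K M σN *ᵥ w) p = σN * w (.inr p) := by
  simp [uncorrelatedB, Matrix.mulVec, dotProduct, Fintype.sum_sum_type, Matrix.one_apply]

variable [MeasurableSpace Ω] {μ : Measure Ω}

theorem generatesUserUncorrelated_uncorrelatedA {σF : ℝ} {R : SourceIdx K M → Ω → ℝ}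
    (hR : iIndepFun R μ) : GeneratesUserUncorrelated μ (uncorrelatedA K M σF) R := by
  intro k₁ k₂ hk j m
  simp_rw [uncorrelatedA_mulVec]
  exact (hR.indepFun (by simpa using hk)).comp (φ := (σF * ·)) (ψ := (σF * ·))
    (by fun_prop) (by fun_prop)

variable {σF σN : ℝ} {R : SourceIdx K M → Ω → ℝ}

theorem measurable_sourceContribution (hHN : IsFadingChannel μ H N) (x : Fin K → ℝ)
    (i : SourceIdx K M) : Measurable (sourceContribution H N x i) := by
  rcases i with i | p
  · exact ((measurable_cpart _).comp (hHN.measurable_fading i.2.2 i.1)).const_mul _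
  · exact (measurable_cpart _).comp (hHN.measurable_noise p.1)

theorem integral_sourceContribution (hHN : IsFadingChannel μ H N) (x : Fin K → ℝ)
    (i : SourceIdx K M) : ∫ ω, sourceContribution H N x i ω ∂μ = 0 := by
  rcases i with i | p
  · simp [sourceContribution, fadingVec, integral_const_mul, hHN.fading_mean]
  · exact hHN.noise_mean _ _

theorem sourceContribution_eq_mul
    (hR : IsCorrelationModel μ H N (uncorrelatedA K M σF) (uncorrelatedB K M σN) R)
    (x : Fin K → ℝ) (i : SourceIdx K M) :
    sourceContribution H N x i =
      fun ω => Sum.elim (fun j : FadingIdx K M => x j.2.2 * σF) (fun _ => σN) i * R i ω := by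
  ext ω
  rcases i with i | p
  · simp [sourceContribution, hR.fading_eq, uncorrelatedA_mulVec, mul_assoc]
  · simp [sourceContribution, hR.noise_eq, uncorrelatedB_mulVec]

theorem iIndepFun_sourceContribution
    (hR : IsCorrelationModel μ H N (uncorrelatedA K M σF) (uncorrelatedB K M σN) R)
    (x : Fin K → ℝ) : iIndepFun (sourceContribution H N x) μ := by
  have : sourceContribution H N x = fun i => sourceContribution H N x i := rfl
  rw [this]
  simp_rw [sourceContribution_eq_mul hR]
  exact hR.indep.comp (fun i y => Sum.elim (fun j : FadingIdx K M => x j.2.2 * σF)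
    (fun _ => σN) i * y) fun i => by fun_prop

theorem hasSubgaussianMGF_sourceContribution (hHN : IsFadingChannel μ H N)
    (hR : IsCorrelationModel μ H N (uncorrelatedA K M σF) (uncorrelatedB K M σN) R)
    (x : Fin K → ℝ) (i : SourceIdx K M) :
    HasSubgaussianMGF (sourceContribution H N x i)
      (Real.toNNReal (Sum.elim (fun j : FadingIdx K M => x j.2.2 * σF) (fun _ => σN) i ^ 2)) μ := by
  set c := Sum.elim (fun j : FadingIdx K M => x j.2.2 * σF) (fun _ => σN) i with hc
  have h := (hasSubgaussianMGF_of_subgaussianNorm_le_one (hR.norm_le_one i)).const_mul c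
  have hmean := integral_sourceContribution hHN x i
  -- the source itself need not be centered if its coefficient vanishes, but the product is
  rw [sourceContribution_eq_mul hR, ← hc, integral_const_mul] at hmean
  convert! h using 1
  · rw [sourceContribution_eq_mul hR]
    ext ω
    rw [mul_sub, hmean, sub_zero]
  · exact (Real.toNNReal_of_nonneg (sq_nonneg c)).trans (mul_one _).symm

theorem variance_sourceContribution (hHN : IsFadingChannel μ H N)
    (x : Fin K → ℝ) (i : SourceIdx K M) :
    variance (sourceContribution H N x i) μ =
      Sum.elim (fun j : FadingIdx K M => x j.2.2 ^ 2) (fun p => ∫ ω, noiseVec N ω p ^ 2 ∂μ) i := by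
  rcases i with i | p
  · have := hHN.fading_variance i.2.2 i.1 i.2.1
    simp only [sourceContribution, Sum.elim_inl, fadingVec]
    rw [variance_const_mul, this, mul_one]
  · exact variance_of_integral_eq_zero
      (measurable_sourceContribution hHN x (.inr p)).aemeasurable (hHN.noise_mean _ _)

theorem measurable_receivedPart (hHN : IsFadingChannel μ H N) (x : Fin K → ℝ) (p : NoiseIdx M) :
    Measurable (receivedPart H N x p) := by
  rw [funext (receivedPart_apply x p)]
  exact Finset.measurable_sum _ fun i _ => measurable_sourceContribution hHN x i

theorem iIndepFun_receivedPart (hHN : IsFadingChannel μ H N)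
    (hR : IsCorrelationModel μ H N (uncorrelatedA K M σF) (uncorrelatedB K M σN) R)
    (x : Fin K → ℝ) : iIndepFun (receivedPart H N x) μ := by
  have h := iIndepFun_of_pairwise_disjoint (iIndepFun_sourceContribution hR x)
    (measurable_sourceContribution hHN x) receiverBlock pairwise_disjoint_receiverBlock
    (fun p y => ∑ i, y i) fun p => by fun_prop
  convert! h using 1
  ext p ω
  rw [receivedPart_apply,
    Finset.sum_coe_sort (receiverBlock p) fun i => sourceContribution H N x i ω]

theorem hasSubgaussianMGF_receivedPart (hHN : IsFadingChannel μ H N)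
    (hR : IsCorrelationModel μ H N (uncorrelatedA K M σF) (uncorrelatedB K M σN) R)
    (x : Fin K → ℝ) (p : NoiseIdx M) {v : ℝ≥0} (hv : (∑ k, x k ^ 2) * σF ^ 2 + σN ^ 2 ≤ v) :
    HasSubgaussianMGF (receivedPart H N x p) v μ := by
  have h := HasSubgaussianMGF.sum_of_iIndepFun (iIndepFun_sourceContribution hR x)
    (s := receiverBlock p) fun i _ => hasSubgaussianMGF_sourceContribution hHN hR x i
  rw [funext (receivedPart_apply x p)]
  refine HasSubgaussianMGF.mono_const h (NNReal.coe_le_coe.1 (le_trans (le_of_eq ?_) hv))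
  push_cast
  simp_rw [Real.coe_toNNReal _ (sq_nonneg _)]
  rw [sum_receiverBlock]
  simp [mul_pow, Finset.sum_mul]

theorem integral_receivedPart_sq (hHN : IsFadingChannel μ H N)
    (hR : IsCorrelationModel μ H N (uncorrelatedA K M σF) (uncorrelatedB K M σN) R)
    (x : Fin K → ℝ) (p : NoiseIdx M) :
    ∫ ω, receivedPart H N x p ω ^ 2 ∂μ = ∑ k, x k ^ 2 + ∫ ω, noiseVec N ω p ^ 2 ∂μ := by
  have hsub := hasSubgaussianMGF_sourceContribution hHN hR x
  have hind := iIndepFun_sourceContribution hR x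
  have := hind.isProbabilityMeasure
  have hmean : ∫ ω, receivedPart H N x p ω ∂μ = 0 := by
    simp_rw [receivedPart_apply]
    rw [integral_finsetSum _ fun i _ => (hsub i).integrable]
    exact Finset.sum_eq_zero fun i _ => integral_sourceContribution hHN x i
  rw [← variance_of_integral_eq_zero (measurable_receivedPart hHN x p).aemeasurable hmean,
    receivedPart_eq_sum, IndepFun.variance_sum (fun i _ => (hsub i).memLp 2)
      fun i _ j _ hij => hind.indepFun hij]
  simp_rw [variance_sourceContribution hHN]
  rw [sum_receiverBlock]
  simp

end Channel

/-! ### Amplitude modulation of the inner functions -/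

theorem pi_dirac_eq {ι : Type*} [Fintype ι] {α : ι → Type*} [∀ i, MeasurableSpace (α i)]
    (x : ∀ i, α i) :
    Measure.pi (fun i => Measure.dirac (x i)) = Measure.dirac x := by
  refine Measure.pi_eq fun s hs => ?_
  rw [Measure.dirac_apply' _ (.univ_pi hs)]
  rw [Finset.prod_congr rfl fun i _ => Measure.dirac_apply' (x i) (hs i)]
  by_cases h : ∀ i, x i ∈ s i
  · simp [h]
  · rw [Set.indicator_of_notMem (by simpa using h)]
    push Not at h
    obtain ⟨i, hi⟩ := h
    exact (Finset.prod_eq_zero (Finset.mem_univ i) (by simp [hi])).symm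

theorem measurable_channelOutput {Ω : Type*} [MeasurableSpace Ω] {K M : ℕ}
    {H : Fin K → Fin M → Ω → ℂ} {N : Fin M → Ω → ℂ} (hH : ∀ k m, Measurable (H k m))
    (hN : ∀ m, Measurable (N m)) :
    Measurable fun p : (Fin K → Fin M → ℂ) × Ω => channelOutput H N p.1 p.2 := by
  refine measurable_pi_lambda _ fun m => ?_
  unfold channelOutput
  fun_prop

theorem DFAScheme.errorProb_eq_of_dirac {Ω : Type*} [MeasurableSpace Ω] {μ : Measure Ω}
    [SFinite μ] {K M : ℕ} {H : Fin K → Fin M → Ω → ℂ} {N : Fin M → Ω → ℂ} {S : Fin K → Set ℝ}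
    (E : DFAScheme S M)
    (hH : ∀ k m, Measurable (H k m)) (hN : ∀ m, Measurable (N m)) (f : (∀ k, S k) → ℝ)
    (s : ∀ k, S k) (x : Fin K → Fin M → ℂ) (hx : ∀ k, E.enc k (s k) = Measure.dirac (x k))
    (ε : ℝ) :
    E.errorProb μ H N f s ε = μ.real {ω | ε ≤ |E.dec (channelOutput H N x ω) - f s|} := by
  have hm : MeasurableSet {p : (Fin K → Fin M → ℂ) × Ω |
      ε ≤ |E.dec (channelOutput H N p.1 p.2) - f s|} := by
    have := E.measurable_dec.comp (measurable_channelOutput hH hN)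
    exact measurableSet_le measurable_const (this.sub_const _).abs
  rw [DFAScheme.errorProb]
  simp_rw [hx]
  rw [pi_dirac_eq, Measure.dirac_prod, map_measureReal_apply measurable_prodMk_left hm]
  rfl

namespace NomographicRep

variable {Ω : Type*} [MeasurableSpace Ω] {μ : Measure Ω} {K M : ℕ}
  {H : Fin K → Fin M → Ω → ℂ} {N : Fin M → Ω → ℂ} {S : Fin K → Set ℝ} {f : (∀ k, S k) → ℝ}

theorem bddAbove_inner (r : NomographicRep S f) (k : Fin K) :
    BddAbove (Set.range (r.inner k)) := by
  obtain ⟨C, hC⟩ := r.bounded_inner k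
  exact ⟨C, by rintro _ ⟨s, rfl⟩; exact (abs_le.1 (hC s)).2⟩

theorem bddBelow_inner (r : NomographicRep S f) (k : Fin K) :
    BddBelow (Set.range (r.inner k)) := by
  obtain ⟨C, hC⟩ := r.bounded_inner k
  exact ⟨-C, by rintro _ ⟨s, rfl⟩; exact (abs_le.1 (hC s)).1⟩

theorem sub_iInf_nonneg (r : NomographicRep S f) (k : Fin K) (s : S k) :
    0 ≤ r.inner k s - ⨅ s', r.inner k s' :=
  sub_nonneg.2 (ciInf_le (r.bddBelow_inner k) s)

theorem sub_iInf_le_spread (r : NomographicRep S f) (k : Fin K) (s : S k) :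
    r.inner k s - ⨅ s', r.inner k s' ≤ r.spread k :=
  sub_le_sub_right (le_ciSup (r.bddAbove_inner k) s) _

theorem spread_le_maxSpread (r : NomographicRep S f) (k : Fin K) : r.spread k ≤ r.maxSpread :=
  le_ciSup (Set.finite_range _).bddAbove k

theorem spread_nonneg (r : NomographicRep S f) (k : Fin K) : 0 ≤ r.spread k := by
  rcases isEmpty_or_nonempty (S k) with h | ⟨⟨s⟩⟩
  · simp [spread]
  · exact (r.sub_iInf_nonneg k s).trans (r.sub_iInf_le_spread k s)

theorem totalSpread_nonneg (r : NomographicRep S f) : 0 ≤ r.totalSpread :=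
  Finset.sum_nonneg fun k _ => r.spread_nonneg k

theorem maxSpread_nonneg (r : NomographicRep S f) : 0 ≤ r.maxSpread :=
  Real.iSup_nonneg r.spread_nonneg

theorem totalSpread_eq_zero (r : NomographicRep S f) (h : r.maxSpread = 0) :
    r.totalSpread = 0 :=
  Finset.sum_eq_zero fun k _ =>
    le_antisymm (h ▸ r.spread_le_maxSpread k) (r.spread_nonneg k)

/-- The amplitude that user `k` transmits for the message `s`: its energy is the value of the inner
function, shifted and scaled from the range of the inner function into `[0, P]`. The scaling factor
`P / maxSpread` is common to all users; it is `0` if all inner functions are constant. -/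
noncomputable def amplitude (r : NomographicRep S f) (P : ℝ) (k : Fin K) (s : S k) : ℝ :=
  √(P / r.maxSpread * (r.inner k s - ⨅ s', r.inner k s'))

theorem measurable_amplitude (r : NomographicRep S f) (P : ℝ) (k : Fin K) :
    Measurable (r.amplitude P k) :=
  (((r.measurable_inner k).sub_const _).const_mul _).sqrt

theorem amplitude_sq (r : NomographicRep S f) {P : ℝ} (hP : 0 ≤ P) (k : Fin K) (s : S k) :
    r.amplitude P k s ^ 2 = P / r.maxSpread * (r.inner k s - ⨅ s', r.inner k s') :=
  Real.sq_sqrt (mul_nonneg (div_nonneg hP r.maxSpread_nonneg) (r.sub_iInf_nonneg k s))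

theorem amplitude_sq_le (r : NomographicRep S f) {P : ℝ} (hP : 0 ≤ P) (k : Fin K) (s : S k) :
    r.amplitude P k s ^ 2 ≤ P := by
  rw [r.amplitude_sq hP]
  calc P / r.maxSpread * (r.inner k s - ⨅ s', r.inner k s') ≤ P / r.maxSpread * r.maxSpread :=
        mul_le_mul_of_nonneg_left ((r.sub_iInf_le_spread k s).trans (r.spread_le_maxSpread k))
          (div_nonneg hP r.maxSpread_nonneg)
    _ ≤ P := by
        rcases r.maxSpread_nonneg.eq_or_lt with h | h
        · simp [← h, hP]
        · rw [div_mul_cancel₀ _ h.ne']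

/-- The receiver's estimate of `∑ k, inner k (s k)`: the received energy, minus the expected noise
energy `c`, with the shift and the scaling of the amplitudes undone. -/
noncomputable def sumEstimate (r : NomographicRep S f) (P c : ℝ) (y : Fin M → ℂ) : ℝ :=
  r.maxSpread / (2 * M * P) * (∑ p : NoiseIdx M, cpart p.2 (y p.1) ^ 2 - c) +
    ∑ k, ⨅ s, r.inner k s

theorem measurable_sumEstimate (r : NomographicRep S f) (P c : ℝ) :
    Measurable (r.sumEstimate P c : (Fin M → ℂ) → ℝ) := by
  unfold sumEstimate
  have : ∀ p : NoiseIdx M, Measurable fun y : Fin M → ℂ => cpart p.2 (y p.1) := fun p =>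
    (measurable_cpart p.2).comp (measurable_pi_apply p.1)
  fun_prop

/-- The scheme in which every user repeats the amplitude of its message in all channel uses, and the
receiver applies `G` to its estimate of the inner sum. The encoders are deterministic: over
independent centered fading coefficients, the cross terms in the received energy have mean zero
already without randomized signs. -/
noncomputable def amplitudeScheme (r : NomographicRep S f) (M : ℕ) (P c : ℝ) {G : ℝ → ℝ}
    (hG : Measurable G) : DFAScheme S M where
  enc k := Kernel.deterministic (fun s _ => (r.amplitude P k s : ℂ))
    (measurable_pi_lambda _ fun _ => Complex.measurable_ofReal.comp (r.measurable_amplitude P k))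
  isMarkov_enc _ := inferInstance
  dec y := G (r.sumEstimate P c y)
  measurable_dec := hG.comp (r.measurable_sumEstimate P c)

theorem enc_amplitudeScheme (r : NomographicRep S f) (M : ℕ) (P c : ℝ) {G : ℝ → ℝ}
    (hG : Measurable G) (k : Fin K) (s : S k) :
    (r.amplitudeScheme M P c hG).enc k s =
      Measure.dirac fun _ => (r.amplitude P k s : ℂ) :=
  Kernel.deterministic_apply (measurable_pi_lambda _ fun _ =>
    Complex.measurable_ofReal.comp (r.measurable_amplitude P k)) s

theorem powerConstrained_amplitudeScheme (r : NomographicRep S f) (M : ℕ) {P : ℝ} (hP : 0 ≤ P)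
    (c : ℝ) {G : ℝ → ℝ} (hG : Measurable G) :
    (r.amplitudeScheme M P c hG).PowerConstrained P := by
  intro k s
  rw [enc_amplitudeScheme, ae_dirac_iff]
  · intro m
    rw [Complex.norm_real, Real.norm_eq_abs, sq_abs]
    exact r.amplitude_sq_le hP k s
  · rw [Set.ofPred_forall]
    exact MeasurableSet.iInter fun m => measurableSet_le (by fun_prop) measurable_const

/-- The estimate of the inner sum is unbiased: its error is the scaled deviation of the received
energy from its expectation. -/
theorem sumEstimate_sub_sum_inner (r : NomographicRep S f) {P : ℝ} (hP : 0 < P) (hM : 0 < M)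
    (hΔ : 0 < r.maxSpread) (hHN : IsFadingChannel μ H N) {σF σN : ℝ} {R : SourceIdx K M → Ω → ℝ}
    (hR : IsCorrelationModel μ H N (uncorrelatedA K M σF) (uncorrelatedB K M σN) R)
    (s : ∀ k, S k) (ω : Ω) :
    r.sumEstimate P (∑ p : NoiseIdx M, ∫ ω', noiseVec N ω' p ^ 2 ∂μ)
        (channelOutput H N (fun k _ => (r.amplitude P k (s k) : ℂ)) ω) - ∑ k, r.inner k (s k) =
      r.maxSpread / (2 * M * P) *
        ∑ p, (receivedPart H N (fun k => r.amplitude P k (s k)) p ω ^ 2 -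
          ∫ ω', receivedPart H N (fun k => r.amplitude P k (s k)) p ω' ^ 2 ∂μ) := by
  have hM' : (0 : ℝ) < M := by exact_mod_cast hM
  simp_rw [integral_receivedPart_sq hHN hR, r.amplitude_sq hP.le]
  rw [Finset.sum_sub_distrib, Finset.sum_add_distrib, ← Finset.mul_sum, Finset.sum_sub_distrib,
    sumEstimate]
  simp only [receivedPart, Finset.sum_const, Finset.card_univ, Fintype.card_prod, Fintype.card_fin,
    nsmul_eq_mul, Nat.cast_mul, Nat.cast_ofNat]
  field_simp
  ring

/-- Bernstein's inequality for the `2 M` real and imaginary parts of the channel output, which are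
sub-gaussian with variance proxy at most `P / maxSpread * L'`. -/
theorem measureReal_sumEstimate_le [IsProbabilityMeasure μ] (r : NomographicRep S f) {P : ℝ}
    (hP : 0 < P) (hM : 0 < M) (hHN : IsFadingChannel μ H N) {σF σN : ℝ} (hσF : 0 ≤ σF)
    (hσN : 0 ≤ σN) {R : SourceIdx K M → Ω → ℝ}
    (hR : IsCorrelationModel μ H N (uncorrelatedA K M σF) (uncorrelatedB K M σN) R)
    {L : ℝ} (hL : L = constL' r.totalSpread r.maxSpread P σF σN) (hL0 : 0 < L)
    (s : ∀ k, S k) {t : ℝ} (ht : 0 < t) :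
    μ.real {ω | t ≤ |r.sumEstimate P (∑ p : NoiseIdx M, ∫ ω', noiseVec N ω' p ^ 2 ∂μ)
        (channelOutput H N (fun k _ => (r.amplitude P k (s k) : ℂ)) ω) -
          ∑ k, r.inner k (s k)|} ≤
      2 * Real.exp (-(M * t ^ 2 / (54 * L ^ 2 + 10 * L * t))) := by
  have hM' : (0 : ℝ) < M := by exact_mod_cast hM
  have hΔ : 0 < r.maxSpread := by
    refine r.maxSpread_nonneg.lt_of_ne fun h => hL0.ne' ?_
    rw [hL, constL', r.totalSpread_eq_zero h.symm, ← h]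
    simp
  set Δ := r.maxSpread with hΔdef
  set x : Fin K → ℝ := fun k => r.amplitude P k (s k) with hx
  have hv0 : 0 < P / Δ * L := by positivity
  obtain ⟨v, hv⟩ : ∃ v : ℝ≥0, (v : ℝ) = P / Δ * L := ⟨⟨_, hv0.le⟩, rfl⟩
  have hvle : (∑ k, x k ^ 2) * σF ^ 2 + σN ^ 2 ≤ v := by
    rw [hv]
    have h1 : ∑ k, x k ^ 2 ≤ P / Δ * r.totalSpread := by
      rw [totalSpread, Finset.mul_sum]
      refine Finset.sum_le_sum fun k _ => ?_
      rw [hx, r.amplitude_sq hP.le]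
      exact mul_le_mul_of_nonneg_left (r.sub_iInf_le_spread k (s k)) (by positivity)
    have h2 : r.totalSpread * σF ^ 2 + Δ / P * σN ^ 2 ≤ L := by
      rw [hL, constL', add_sq, mul_pow, mul_pow, Real.sq_sqrt r.totalSpread_nonneg,
        Real.sq_sqrt (by positivity)]
      have : 0 ≤ 2 * (√r.totalSpread * σF) * (√(Δ / P) * σN) := by positivity
      linarith
    calc (∑ k, x k ^ 2) * σF ^ 2 + σN ^ 2
        ≤ P / Δ * r.totalSpread * σF ^ 2 + σN ^ 2 := by gcongr
      _ = P / Δ * (r.totalSpread * σF ^ 2 + Δ / P * σN ^ 2) := by field_simp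
      _ ≤ P / Δ * L := by gcongr
  have hu : 0 < P / Δ * t := by positivity
  have key := measureReal_sum_sq_sub_ge_le (iIndepFun_receivedPart hHN hR x)
    (measurable_receivedPart hHN x) (NNReal.coe_pos.1 (hv ▸ hv0))
    (fun p => hasSubgaussianMGF_receivedPart hHN hR x p hvle) hu
  refine le_trans (measureReal_mono fun ω hω => ?_) (key.trans_eq ?_)
  · simp only [Set.mem_ofPred_eq] at hω ⊢
    rw [r.sumEstimate_sub_sum_inner hP hM hΔ hHN hR, abs_mul, abs_of_pos (by positivity)] at hω
    simp only [Fintype.card_prod, Fintype.card_fin]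
    push_cast
    calc (M : ℝ) * 2 * (P / Δ * t) = 2 * M * P / Δ * t := by ring
      _ ≤ 2 * M * P / Δ * (Δ / (2 * M * P) * _) := by gcongr
      _ = _ := by rw [← mul_assoc, hx]; field_simp
  · simp only [Fintype.card_prod, Fintype.card_fin, hv]
    push_cast
    congr 3
    field_simp
    ring

end NomographicRep

/-! ### The error bound -/

theorem mainTheorem2 {Ω : Type*} [MeasurableSpace Ω] (μ : Measure Ω) [IsProbabilityMeasure μ]
    (K M : ℕ) (hM : 0 < M) (P : ℝ) (hP : 0 < P)
    (S : Fin K → Set ℝ) (hS : ∀ k, IsClosed (S k))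
    (f : (∀ k, S k) → ℝ) (hf : Measurable f)
    (r : NomographicRep S f) (Φ : ℝ → ℝ) (hΦ : r.IsIncrementMajorant Φ)
    (H : Fin K → Fin M → Ω → ℂ) (N : Fin M → Ω → ℂ) (hHN : IsFadingChannel μ H N)
    (σF σN : ℝ) (hσF : 0 ≤ σF) (hσN : 0 ≤ σN) (R : SourceIdx K M → Ω → ℝ)
    (hR : IsCorrelationModel μ H N (uncorrelatedA K M σF) (uncorrelatedB K M σN) R) :
    (∃ E : DFAScheme S M, E.PowerConstrained P ∧
      ∀ (s : ∀ k, S k) (ε : ℝ), 0 < ε →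
        E.errorProb μ H N f s ε ≤
          2 * Real.exp (-(M * majorantInv Φ ε ^ 2 /
            (16 * constF' K r.totalSpread r.maxSpread P σF σN
              + 4 * majorantInv Φ ε * constL' r.totalSpread r.maxSpread P σF σN))) +
          2 * Real.exp (-(M * majorantInv Φ ε ^ 2 /
            (256 * constF' K r.totalSpread r.maxSpread P σF σN
              + 32 * majorantInv Φ ε * constL' r.totalSpread r.maxSpread P σF σN)))) ∧
    GeneratesUserUncorrelated μ (uncorrelatedA K M σF) R ∧
    constL r.totalSpread r.maxSpread P (uncorrelatedA K M σF) (uncorrelatedB K M σN) =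
      constL' r.totalSpread r.maxSpread P σF σN ∧
    constF r.totalSpread r.maxSpread P (uncorrelatedA K M σF) (uncorrelatedB K M σN) =
      constF' K r.totalSpread r.maxSpread P σF σN ∧
    constD r.totalSpread r.maxSpread P (uncorrelatedA K M σF) (uncorrelatedA K M σF)
      (uncorrelatedB K M σN) = 0 := by
  have hK0 : K = 0 → r.totalSpread = 0 := by
    rintro rfl
    simp [NomographicRep.totalSpread]
  refine ⟨?_, generatesUserUncorrelated_uncorrelatedA hR.indep,
    constL_uncorrelated hM hσF hσN hK0, constF_uncorrelated hM hσF hσN hK0,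
    constD_uncorrelated ..⟩
  obtain ⟨G, hGm, hG⟩ := exists_measurable_majorantInv_le_two_mul_abs_sub hΦ.strictMonoOn.monotoneOn
    hΦ.abs_sub_le
  set c := ∑ p : NoiseIdx M, ∫ ω, noiseVec N ω p ^ 2 ∂μ with hc
  refine ⟨r.amplitudeScheme M P c hGm, r.powerConstrained_amplitudeScheme M hP.le c hGm,
    fun s ε _ => ?_⟩
  rw [DFAScheme.errorProb_eq_of_dirac _ hHN.measurable_fading hHN.measurable_noise f s
    (fun k _ => (r.amplitude P k (s k) : ℂ)) fun k => r.enc_amplitudeScheme ..]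
  set t := majorantInv Φ ε with ht
  have ht0 : 0 ≤ t := majorantInv_nonneg Φ ε
  -- if `t = 0` or `L' = 0`, the quotients vanish and the right-hand side is `4`
  rcases ht0.eq_or_lt with ht' | ht'
  · simp only [← ht']
    refine measureReal_le_one.trans ?_
    norm_num
  set L := constL' r.totalSpread r.maxSpread P σF σN with hL
  have hL0 : 0 ≤ L := sq_nonneg _
  rcases hL0.eq_or_lt with hL' | hL'
  · have hF : constF' K r.totalSpread r.maxSpread P σF σN = 0 := by
      rw [constF', ← hL, ← hL', zero_mul]
    simp only [← hL', hF]
    refine measureReal_le_one.trans ?_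
    norm_num
  have hKpos : 0 < K := by
    refine Nat.pos_of_ne_zero fun h => hL'.ne' ?_
    subst h
    simp [hL, constL', hK0, NomographicRep.maxSpread]
  have hF := two_mul_constL'_sq_le_constF' (Δm := r.maxSpread) (P := P) hKpos hσF hσN
    r.totalSpread_nonneg
  rw [← hL] at hF
  set F := constF' K r.totalSpread r.maxSpread P σF σN
  have hbound := r.measureReal_sumEstimate_le hP hM hHN hσF hσN hR hL hL' s (half_pos ht')
  have hsub : {ω | ε ≤ |(r.amplitudeScheme M P c hGm).dec
      (channelOutput H N (fun k _ => (r.amplitude P k (s k) : ℂ)) ω) - f s|} ⊆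
      {ω | t / 2 ≤ |r.sumEstimate P c
        (channelOutput H N (fun k _ => (r.amplitude P k (s k) : ℂ)) ω) -
          ∑ k, r.inner k (s k)|} := by
    intro ω hω
    rw [Set.mem_ofPred_eq, r.eq_outer] at hω
    have := hG _ ⟨_, r.sum_mem s⟩ ε hω
    rw [Set.mem_ofPred_eq]
    linarith
  refine (measureReal_mono hsub).trans (hbound.trans ?_)
  -- the second exponential of the claim alone dominates the bound
  have hexp : M * t ^ 2 / (256 * F + 32 * t * L) ≤
      M * (t / 2) ^ 2 / (54 * L ^ 2 + 10 * L * (t / 2)) := by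
    have e : M * (t / 2) ^ 2 / (54 * L ^ 2 + 10 * L * (t / 2)) =
        M * t ^ 2 / (216 * L ^ 2 + 20 * t * L) := by field_simp; ring
    rw [e]
    have : 0 < t * L := by positivity
    refine div_le_div_of_nonneg_left (by positivity) (by positivity) ?_
    linarith [sq_nonneg L]
  have := Real.exp_le_exp.2 (neg_le_neg hexp)
  have h0 := Real.exp_pos (-(M * t ^ 2 / (16 * F + 4 * t * L)))
  linarith
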